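/- All $C^*$-algebras are unital (the zero algebra is allowed), $\otimes$ is the spatial tensor product and $\iota$ denotes identity maps. A compact quantum group $G=(\mathcal A,\Delta)$ is a unital $C^*$-algebra $\mathcal A$ with a unital $^*$-homomorphism $\Delta:\mathcal A\to\mathcal A\otimes\mathcal A$ such that $(\Delta\otimes\iota)\circ\Delta=(\iota\otimes\Delta)\circ\Delta$ and both $\{(b\otimes I)\Delta(c): b,c\in\mathcal A\}$ and $\{(I\otimes b)\Delta(c): b,c\in\mathcal A\}$ span dense subspaces of $\mathcal A\otimes\mathcal A$. A compact quantum subgroup of $G$ is a pair $K=(\mathcal A',\Delta')$, with $\mathcal A'$ a unital $C^*$-algebra and $\Delta':\mathcal A'\to\mathcal A'\otimes\mathcal A'$ a unital $^*$-homomorphism, together with a surjective unital $^*$-homomorphism $\pi:\mathcal A\to\mathcal A'$ such that $(\pi\otimes\pi)\circ\Delta=\Delta'\circ\pi$. Its right coset space is the $C^*$-algebra $\mathcal A^{\delta'_K}=\{a\in\mathcal A:(\pi\otimes\iota)(\Delta(a))=I\otimes a\}$, on which $G$ acts by the restriction $\eta'$ of $\Delta$. An action of $G$ on a unital $C^*$-algebra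 $\mathcal C$ is a unital $^*$-homomorphism $\delta:\mathcal C\to\mathcal C\otimes\mathcal A$ with $(\delta\otimes\iota)\circ\delta=(\iota\otimes\Delta)\circ\delta$; it is faithful if $\delta$ is injective. An everywhere defined counit of $G$ is a unital $^*$-homomorphism $e:\mathcal A\to\mathbb C$ with $(\iota\otimes e)(\Delta(a))=a$ for all $a\in\mathcal A$. **Theorem.** Let $\delta:\mathcal C\to\mathcal C\otimes\mathcal A$ be an action of a compact quantum group $G=(\mathcal A,\Delta)$ on a unital $C^*$-algebra $\mathcal C$, let $\chi:\mathcal C\to\mathbb C$ be a character, and let $T_\chi:=(\chi\otimes\iota)\circ\delta:\mathcal C\to\mathcal A$. Then there is a compact quantum subgroup $G_\chi=(\mathcal A',\Delta')$ of $G$, itself a compact quantum group, whose quotient map $\pi:\mathcal A\to\mathcal A'$ has as kernel the closed two-sided ideal of $\mathcal A$ generated by $\{T_\chi(c)-\chi(c)I: c\in\mathcal C\}$, such that: 1. $T_\chi$ is a $^*$-homomorphism of $\mathcal C$ into the right coset space $\mathcal A^{\delta'_{G_\chi}}$ and intertwines the actions of $G$: $\eta'\circ T_\chi=(T_\chi\otimes\iota)\circ\delta$;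 2. $\pi(T_\chi(c))=\chi(c)I_{\mathcal A'}$ for all $c\in\mathcal C$. Moreover, if $\delta$ is faithful and $G$ has an everywhere defined counit $e$, then $e(T_\chi(c))=\chi(c)$ for all $c\in\mathcal C$. -/

import Mathlib

universe u

namespace CQG

open scoped TensorProduct InnerProductSpace
open UniformSpace

/-- The Hilbert space tensor product: the completion of the algebraic tensor product of two inner
product spaces. -/
def HilbertTensor (H K : Type u) [NormedAddCommGroup H] [InnerProductSpace ℂ H]
    [NormedAddCommGroup K] [InnerProductSpace ℂ K] : Type u :=
  Completion (H ⊗[ℂ] K)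

section Operators

variable {H K : Type u} [NormedAddCommGroup H] [InnerProductSpace ℂ H]
  [NormedAddCommGroup K] [InnerProductSpace ℂ K]

noncomputable instance : NormedAddCommGroup (HilbertTensor H K) :=
  inferInstanceAs (NormedAddCommGroup (Completion (H ⊗[ℂ] K)))

noncomputable instance : InnerProductSpace ℂ (HilbertTensor H K) :=
  inferInstanceAs (InnerProductSpace ℂ (Completion (H ⊗[ℂ] K)))

instance : CompleteSpace (HilbertTensor H K) :=
  inferInstanceAs (CompleteSpace (Completion (H ⊗[ℂ] K)))

/-- The inclusion of the algebraic tensor product into the Hilbert space tensor product. -/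
noncomputable def toHilbert : H ⊗[ℂ] K →ₗᵢ[ℂ] HilbertTensor H K :=
  (Completion.toComplₗᵢ : H ⊗[ℂ] K →ₗᵢ[ℂ] Completion (H ⊗[ℂ] K))

theorem denseRange_toHilbert : DenseRange (toHilbert : H ⊗[ℂ] K → HilbertTensor H K) :=
  Completion.denseRange_coe

theorem HilbertTensor.induction {p : HilbertTensor H K → Prop} (x : HilbertTensor H K)
    (hp : IsClosed {x | p x}) (ih : ∀ x : H ⊗[ℂ] K, p (toHilbert x)) : p x :=
  isClosed_property denseRange_toHilbert hp ih x

/-- The operator `S ⊗ T` on the Hilbert space tensor product. -/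
noncomputable def opTensor (S : H →L[ℂ] H) (T : K →L[ℂ] K) :
    HilbertTensor H K →L[ℂ] HilbertTensor H K :=
  (TensorProduct.mapL S T).completion

theorem opTensor_coe (S : H →L[ℂ] H) (T : K →L[ℂ] K) (x : H ⊗[ℂ] K) :
    opTensor S T (toHilbert x) = toHilbert (TensorProduct.mapL S T x) :=
  ContinuousLinearMap.completion_apply_coe _ _

theorem hilbertTensor_ext {S T : HilbertTensor H K →L[ℂ] HilbertTensor H K}
    (h : ∀ x : H ⊗[ℂ] K, S (toHilbert x) = T (toHilbert x)) : S = T := by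
  ext x
  exact HilbertTensor.induction x (isClosed_eq S.continuous T.continuous) h

theorem opTensor_one : opTensor (1 : H →L[ℂ] H) (1 : K →L[ℂ] K) = 1 :=
  hilbertTensor_ext fun x => by
    rw [opTensor_coe]; exact congrArg _ (congrArg (fun f => f x) TensorProduct.mapL_id_id)

theorem opTensor_mul (S S' : H →L[ℂ] H) (T T' : K →L[ℂ] K) :
    opTensor (S * S') (T * T') = opTensor S T * opTensor S' T' :=
  hilbertTensor_ext fun x => by
    rw [mul_apply_eq_comp, opTensor_coe, opTensor_coe, opTensor_coe,
      TensorProduct.mapL_mul]; rfl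

theorem opTensor_add_left (S S' : H →L[ℂ] H) (T : K →L[ℂ] K) :
    opTensor (S + S') T = opTensor S T + opTensor S' T :=
  hilbertTensor_ext fun x => by
    rw [add_apply, opTensor_coe, opTensor_coe, opTensor_coe,
      TensorProduct.mapL_add_left, add_apply, map_add]

theorem opTensor_add_right (S : H →L[ℂ] H) (T T' : K →L[ℂ] K) :
    opTensor S (T + T') = opTensor S T + opTensor S T' :=
  hilbertTensor_ext fun x => by
    rw [add_apply, opTensor_coe, opTensor_coe, opTensor_coe,
      TensorProduct.mapL_add_right, add_apply, map_add]

theorem opTensor_smul_left (r : ℂ) (S : H →L[ℂ] H) (T : K →L[ℂ] K) :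
    opTensor (r • S) T = r • opTensor S T :=
  hilbertTensor_ext fun x => by
    rw [smul_apply, opTensor_coe, opTensor_coe,
      TensorProduct.mapL_smul_left, smul_apply, map_smul]

theorem opTensor_smul_right (r : ℂ) (S : H →L[ℂ] H) (T : K →L[ℂ] K) :
    opTensor S (r • T) = r • opTensor S T :=
  hilbertTensor_ext fun x => by
    rw [smul_apply, opTensor_coe, opTensor_coe,
      TensorProduct.mapL_smul_right, smul_apply, map_smul]

theorem norm_opTensor_le (S : H →L[ℂ] H) (T : K →L[ℂ] K) : ‖opTensor S T‖ ≤ ‖S‖ * ‖T‖ := by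
  refine ContinuousLinearMap.opNorm_le_bound _ (by positivity) fun x => ?_
  induction x using HilbertTensor.induction with
  | hp => apply isClosed_le <;> fun_prop
  | ih x =>
    rw [opTensor_coe, LinearIsometry.norm_map, LinearIsometry.norm_map]
    exact (TensorProduct.mapL S T).le_of_opNorm_le (TensorProduct.norm_mapL_le S T) x

variable [CompleteSpace H] [CompleteSpace K]

theorem inner_mapL_left (S : H →L[ℂ] H) (T : K →L[ℂ] K) (x y : H ⊗[ℂ] K) :
    ⟪TensorProduct.mapL (star S) (star T) x, y⟫_ℂ = ⟪x, TensorProduct.mapL S T y⟫_ℂ := by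
  induction x using TensorProduct.induction_on with
  | zero => simp
  | add x x' hx hx' => simp only [map_add, inner_add_left, hx, hx']
  | tmul h k =>
    induction y using TensorProduct.induction_on with
    | zero => simp
    | add y y' hy hy' => simp only [map_add, inner_add_right, hy, hy']
    | tmul h' k' =>
      simp [ContinuousLinearMap.star_eq_adjoint, ContinuousLinearMap.adjoint_inner_left]

theorem opTensor_star (S : H →L[ℂ] H) (T : K →L[ℂ] K) :
    opTensor (star S) (star T) = star (opTensor S T) := by
  rw [ContinuousLinearMap.star_eq_adjoint (opTensor S T), ContinuousLinearMap.eq_adjoint_iff]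
  intro x y
  induction x using HilbertTensor.induction with
  | hp => apply isClosed_eq <;> fun_prop
  | ih x =>
    induction y using HilbertTensor.induction with
    | hp => apply isClosed_eq <;> fun_prop
    | ih y =>
      rw [opTensor_coe, opTensor_coe, LinearIsometry.inner_map_map, LinearIsometry.inner_map_map,
        inner_mapL_left]

end Operators

section ProductRep

variable {A B : Type u} [CStarAlgebra A] [CStarAlgebra B]
variable {H K : Type u} [NormedAddCommGroup H] [InnerProductSpace ℂ H] [CompleteSpace H]
  [NormedAddCommGroup K] [InnerProductSpace ℂ K] [CompleteSpace K]

/-- The product representation `a ⊗ b ↦ ρ a ⊗ σ b` of the algebraic tensor product. -/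
noncomputable def algProdRep (ρ : A →⋆ₐ[ℂ] (H →L[ℂ] H)) (σ : B →⋆ₐ[ℂ] (K →L[ℂ] K)) :
    A ⊗[ℂ] B →⋆ₐ[ℂ] (HilbertTensor H K →L[ℂ] HilbertTensor H K) :=
  let L : A ⊗[ℂ] B →ₗ[ℂ] (HilbertTensor H K →L[ℂ] HilbertTensor H K) :=
    TensorProduct.lift (LinearMap.mk₂ ℂ (fun a b => opTensor (ρ a) (σ b))
      (fun a a' b => by rw [map_add, opTensor_add_left])
      (fun r a b => by rw [map_smul, opTensor_smul_left])
      (fun a b b' => by rw [map_add, opTensor_add_right])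
      (fun r a b => by rw [map_smul, opTensor_smul_right]))
  have hL : ∀ a b, L (a ⊗ₜ b) = opTensor (ρ a) (σ b) := fun _ _ => rfl
  { Algebra.TensorProduct.algHomOfLinearMapTensorProduct L
      (fun a a' b b' => by rw [hL, hL, hL, map_mul, map_mul, opTensor_mul])
      (by rw [hL, map_one, map_one, opTensor_one]) with
    map_star' := fun x => by
      change L (star x) = star (L x)
      induction x using TensorProduct.induction_on with
      | zero => rw [star_zero, map_zero, star_zero]
      | add x y hx hy => rw [star_add, map_add, map_add, hx, hy, star_add]
      | tmul a b => rw [TensorProduct.star_tmul, hL, hL, map_star, map_star, opTensor_star] }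

theorem algProdRep_tmul (ρ : A →⋆ₐ[ℂ] (H →L[ℂ] H)) (σ : B →⋆ₐ[ℂ] (K →L[ℂ] K)) (a : A) (b : B) :
    algProdRep ρ σ (a ⊗ₜ b) = opTensor (ρ a) (σ b) := rfl


/-- The unital `*`-representations of `A` on Hilbert spaces (in the universe of `A`, which contains
the universal representation of `A`). -/
structure Rep (A : Type u) [CStarAlgebra A] where
  H : Type u
  [normed : NormedAddCommGroup H]
  [innerProd : InnerProductSpace ℂ H]
  [complete : CompleteSpace H]
  hom : A →⋆ₐ[ℂ] (H →L[ℂ] H)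

attribute [instance] Rep.normed Rep.innerProd Rep.complete

theorem algProdRep_bdd (t : A ⊗[ℂ] B) :
    BddAbove (Set.range fun p : Rep A × Rep B => ‖algProdRep p.1.hom p.2.hom t‖) := by
  induction t using TensorProduct.induction_on with
  | zero => exact ⟨0, by rintro _ ⟨p, rfl⟩; simp⟩
  | add x y hx hy =>
    obtain ⟨M, hM⟩ := hx
    obtain ⟨N, hN⟩ := hy
    refine ⟨M + N, ?_⟩
    rintro _ ⟨p, rfl⟩
    simp only [map_add]
    exact (norm_add_le _ _).trans (add_le_add (hM ⟨p, rfl⟩) (hN ⟨p, rfl⟩))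
  | tmul a b =>
    refine ⟨‖a‖ * ‖b‖, ?_⟩
    rintro _ ⟨p, rfl⟩
    simp only [algProdRep_tmul]
    exact (norm_opTensor_le _ _).trans (mul_le_mul (NonUnitalStarAlgHom.norm_apply_le _ a)
      (NonUnitalStarAlgHom.norm_apply_le _ b) (norm_nonneg _) (norm_nonneg _))

/-- The spatial (minimal) `C*`-norm on the algebraic tensor product: the supremum of the norms in
all product representations. It is attained at the product of the universal representations. -/
noncomputable def spatialNorm (t : A ⊗[ℂ] B) : ℝ :=
  ⨆ p : Rep A × Rep B, ‖algProdRep p.1.hom p.2.hom t‖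

/-- The representation on the zero Hilbert space. -/
noncomputable def Rep.zero (A : Type u) [CStarAlgebra A] : Rep A where
  H := PUnit.{u+1}
  hom :=
    { toFun := fun _ => 0
      map_one' := Subsingleton.elim _ _
      map_mul' := fun _ _ => Subsingleton.elim _ _
      map_zero' := rfl
      map_add' := fun _ _ => Subsingleton.elim _ _
      commutes' := fun _ => Subsingleton.elim _ _
      map_star' := fun _ => Subsingleton.elim _ _ }

noncomputable instance : Inhabited (Rep A) := ⟨Rep.zero A⟩

theorem norm_algProdRep_le (t : A ⊗[ℂ] B) (ρ : Rep A) (σ : Rep B) :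
    ‖algProdRep ρ.hom σ.hom t‖ ≤ spatialNorm t :=
  le_ciSup (algProdRep_bdd t) (ρ, σ)

theorem spatialNorm_le (t : A ⊗[ℂ] B) {M : ℝ}
    (h : ∀ (ρ : Rep A) (σ : Rep B), ‖algProdRep ρ.hom σ.hom t‖ ≤ M) : spatialNorm t ≤ M :=
  ciSup_le fun p => h p.1 p.2

theorem spatialNorm_nonneg (t : A ⊗[ℂ] B) : 0 ≤ spatialNorm t :=
  Real.iSup_nonneg fun _ => norm_nonneg _

end ProductRep

section GelfandNaimark

open scoped ComplexStarModule ComplexOrder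

theorem exists_positive_functional {A : Type u} [CStarAlgebra A] [PartialOrder A]
    [StarOrderedRing A] (b : A) (hb : 0 ≤ b) (hb0 : b ≠ 0) :
    ∃ f : A →ₚ[ℂ] ℂ, f 1 = 1 ∧ f b = ‖b‖ := by
  have : Nontrivial A := ⟨b, 0, hb0⟩
  have hbn : 0 < ‖b‖ := norm_pos_iff.mpr hb0
  have hn : ‖algebraMap ℝ A ‖b‖ + b‖ = 2 * ‖b‖ := by
    apply le_antisymm
    · refine (norm_add_le _ _).trans ?_
      rw [norm_algebraMap', norm_norm, two_mul]
    · have h := CStarAlgebra.norm_mem_spectrum_of_nonneg hb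
      have h2 : ‖b‖ + ‖b‖ ∈ spectrum ℝ (algebraMap ℝ A ‖b‖ + b) :=
        spectrum.add_mem_iff.mpr (by simpa using h)
      have := spectrum.norm_le_norm_of_mem h2
      rw [Real.norm_of_nonneg (by positivity)] at this
      linarith
  obtain ⟨g, hg, hgv⟩ := exists_dual_vector'' ℝ (algebraMap ℝ A ‖b‖ + b)
  have hle : ∀ x, g x ≤ ‖x‖ := fun x => (le_abs_self _).trans (by
    simpa using g.le_of_opNorm_le hg x)
  have h1 : g 1 ≤ 1 := by simpa using hle 1
  have h2 : g b ≤ ‖b‖ := hle b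
  have h3 : ‖b‖ * g 1 + g b = 2 * ‖b‖ := by
    rw [hn, map_add, Algebra.algebraMap_eq_smul_one, map_smul] at hgv
    simpa using hgv
  have hg1 : g 1 = 1 := by nlinarith
  have hgb : g b = ‖b‖ := by rw [hg1] at h3; linarith
  have hpos : ∀ x : A, 0 ≤ x → 0 ≤ g x := by
    intro x hx
    have hx1 : x ≤ algebraMap ℝ A ‖x‖ := IsSelfAdjoint.le_algebraMap_norm_self (.of_nonneg hx)
    have h4 : ‖algebraMap ℝ A ‖x‖ - x‖ ≤ ‖algebraMap ℝ A ‖x‖‖ :=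
      CStarAlgebra.norm_le_norm_of_nonneg_of_le (sub_nonneg.mpr hx1) (sub_le_self _ hx)
    rw [norm_algebraMap', norm_norm] at h4
    have h5 := (hle _).trans h4
    rw [map_sub, Algebra.algebraMap_eq_smul_one, map_smul, hg1, smul_eq_mul, mul_one] at h5
    linarith
  let f₀ : A →ₗ[ℂ] ℂ :=
    { toFun := fun x => (g (ℜ x : A) : ℂ) + Complex.I * (g (ℑ x : A) : ℂ)
      map_add' := fun x y => by simp; ring
      map_smul' := fun r x => by
        simp [realPart_smul, imaginaryPart_smul]
        apply Complex.ext <;> simp }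
  have hf : ∀ x : A, IsSelfAdjoint x → f₀ x = (g x : ℂ) := fun x hx => by
    simp [f₀, hx.coe_realPart, hx.imaginaryPart]
  refine ⟨PositiveLinearMap.mk₀ f₀ fun x hx => ?_, ?_, ?_⟩
  · rw [hf x (.of_nonneg hx)]
    exact_mod_cast hpos x hx
  · exact (hf 1 (.one _)).trans (by rw [hg1]; simp)
  · exact (hf b (.of_nonneg hb)).trans (by rw [hgb])

/-- Every element of a `C*`-algebra attains its norm in some representation. -/
theorem exists_rep_norm_le {A : Type u} [CStarAlgebra A] (a : A) :
    ∃ ρ : Rep A, ‖a‖ ≤ ‖ρ.hom a‖ := by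
  rcases eq_or_ne a 0 with rfl | ha
  · exact ⟨default, by simp⟩
  let _ : PartialOrder A := CStarAlgebra.spectralOrder A
  have _ : StarOrderedRing A := CStarAlgebra.spectralOrderedRing A
  obtain ⟨f, hf1, hfa⟩ := exists_positive_functional (star a * a) (star_mul_self_nonneg a)
    (by simpa using ha)
  refine ⟨⟨f.GNS, f.gnsStarAlgHom⟩, ?_⟩
  have h1 : ‖((f.toPreGNS 1 : f.PreGNS) : f.GNS)‖ = 1 := by
    rw [Completion.norm_coe, PositiveLinearMap.preGNS_norm_def]
    simp [hf1]
  have h2 : ‖f.gnsStarAlgHom a ((f.toPreGNS 1 : f.PreGNS) : f.GNS)‖ = ‖a‖ := by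
    have : f.gnsStarAlgHom a ((f.toPreGNS 1 : f.PreGNS) : f.GNS) =
        ((f.toPreGNS a : f.PreGNS) : f.GNS) := by
      simp
    rw [this, Completion.norm_coe, PositiveLinearMap.preGNS_norm_def]
    simp only [PositiveLinearMap.ofPreGNS_toPreGNS]
    rw [hfa, CStarRing.norm_star_mul_self, Complex.ofReal_re, Real.sqrt_mul_self (norm_nonneg a)]
  calc ‖a‖ = ‖f.gnsStarAlgHom a ((f.toPreGNS 1 : f.PreGNS) : f.GNS)‖ := h2.symm
    _ ≤ ‖f.gnsStarAlgHom a‖ * ‖((f.toPreGNS 1 : f.PreGNS) : f.GNS)‖ :=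
      ContinuousLinearMap.le_opNorm _ _
    _ = ‖f.gnsStarAlgHom a‖ := by rw [h1, mul_one]

end GelfandNaimark

/-- The algebraic tensor product, to be equipped with the spatial norm. -/
def AlgTensor (A B : Type u) [CStarAlgebra A] [CStarAlgebra B] : Type u := A ⊗[ℂ] B

namespace AlgTensor

variable {A B : Type u} [CStarAlgebra A] [CStarAlgebra B]

noncomputable instance : Ring (AlgTensor A B) := inferInstanceAs (Ring (A ⊗[ℂ] B))
noncomputable instance : Algebra ℂ (AlgTensor A B) := inferInstanceAs (Algebra ℂ (A ⊗[ℂ] B))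
noncomputable instance : StarRing (AlgTensor A B) := inferInstanceAs (StarRing (A ⊗[ℂ] B))
instance : StarModule ℂ (AlgTensor A B) := inferInstanceAs (StarModule ℂ (A ⊗[ℂ] B))

/-- The identity map onto the algebraic tensor product. -/
noncomputable def equiv : A ⊗[ℂ] B ≃⋆ₐ[ℂ] AlgTensor A B := StarAlgEquiv.refl ℂ (A ⊗[ℂ] B)

noncomputable instance : Norm (AlgTensor A B) := ⟨fun t => spatialNorm (equiv.symm t)⟩

theorem norm_def (t : AlgTensor A B) : ‖t‖ = spatialNorm (equiv.symm t) := rfl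

noncomputable instance : SeminormedRing (AlgTensor A B) :=
  { (inferInstance : Ring (AlgTensor A B)),
    SeminormedAddCommGroup.ofCore (𝕜 := ℂ) (E := AlgTensor A B)
      { norm_nonneg := fun t => spatialNorm_nonneg _
        norm_smul := fun r t => by
          rw [norm_def, norm_def, map_smul, spatialNorm, spatialNorm,
            Real.mul_iSup_of_nonneg (norm_nonneg r)]
          exact iSup_congr fun p => by rw [map_smul, norm_smul]
        norm_triangle := fun s t => spatialNorm_le _ fun ρ σ => by
          rw [map_add, map_add]
          exact (norm_add_le _ _).trans
            (add_le_add (norm_algProdRep_le _ ρ σ) (norm_algProdRep_le _ ρ σ)) } with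
    norm_mul_le := fun s t => spatialNorm_le _ fun ρ σ => by
      rw [map_mul, map_mul]
      exact (norm_mul_le _ _).trans
        (mul_le_mul (norm_algProdRep_le _ ρ σ) (norm_algProdRep_le _ ρ σ) (norm_nonneg _)
          (spatialNorm_nonneg _)) }

noncomputable instance : NormedAlgebra ℂ (AlgTensor A B) where
  norm_smul_le r t := by
    rw [norm_def, norm_def]
    exact spatialNorm_le _ fun ρ σ => by
      rw [map_smul, map_smul, norm_smul]
      exact mul_le_mul_of_nonneg_left (norm_algProdRep_le _ ρ σ) (norm_nonneg r)

theorem norm_star' (t : AlgTensor A B) : ‖star t‖ = ‖t‖ := by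
  rw [norm_def, norm_def, spatialNorm, spatialNorm]
  exact iSup_congr fun p => by rw [map_star, map_star, norm_star]

theorem norm_star_mul_self' (t : AlgTensor A B) : ‖t‖ * ‖t‖ ≤ ‖star t * t‖ := by
  have h : ‖t‖ ≤ √‖star t * t‖ := spatialNorm_le _ fun ρ σ => by
    refine Real.le_sqrt_of_sq_le ?_
    rw [sq, ← CStarRing.norm_star_mul_self, ← map_star, ← map_star, ← map_mul, ← map_mul]
    exact norm_algProdRep_le _ ρ σ
  calc ‖t‖ * ‖t‖ ≤ √‖star t * t‖ * √‖star t * t‖ :=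
        mul_le_mul h h (norm_nonneg _) (Real.sqrt_nonneg _)
    _ = ‖star t * t‖ := Real.mul_self_sqrt (norm_nonneg _)

instance : NormedStarGroup (AlgTensor A B) := ⟨fun t => (norm_star' t).le⟩

end AlgTensor

/-- The spatial (minimal) tensor product of two unital `C*`-algebras. -/
def SpatialTensor (A B : Type u) [CStarAlgebra A] [CStarAlgebra B] : Type u :=
  Completion (AlgTensor A B)

namespace SpatialTensor

variable {A B : Type u} [CStarAlgebra A] [CStarAlgebra B]

noncomputable instance : NormedRing (SpatialTensor A B) :=
  inferInstanceAs (NormedRing (Completion (AlgTensor A B)))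

noncomputable instance : Algebra ℂ (SpatialTensor A B) :=
  inferInstanceAs (Algebra ℂ (Completion (AlgTensor A B)))

noncomputable instance : NormedAlgebra ℂ (SpatialTensor A B) where
  norm_smul_le r x := norm_smul_le (β := Completion (AlgTensor A B)) r x

instance : CompleteSpace (SpatialTensor A B) :=
  inferInstanceAs (CompleteSpace (Completion (AlgTensor A B)))

/-- The canonical map of the algebraic tensor product into the spatial one, as a map. -/
noncomputable def coe (t : A ⊗[ℂ] B) : SpatialTensor A B :=
  ((AlgTensor.equiv t : AlgTensor A B) : Completion (AlgTensor A B))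

theorem denseRange_coe : DenseRange (coe : A ⊗[ℂ] B → SpatialTensor A B) :=
  Completion.denseRange_coe (α := AlgTensor A B)

theorem norm_coe (t : A ⊗[ℂ] B) : ‖coe t‖ = spatialNorm t := Completion.norm_coe _

theorem induction {p : SpatialTensor A B → Prop} (x : SpatialTensor A B)
    (hp : IsClosed {x | p x}) (ih : ∀ t : A ⊗[ℂ] B, p (coe t)) : p x :=
  isClosed_property denseRange_coe hp ih x

theorem coe_add (s t : A ⊗[ℂ] B) : coe (s + t) = coe s + coe t :=
  Completion.coe_add (AlgTensor.equiv s) (AlgTensor.equiv t)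

theorem coe_mul (s t : A ⊗[ℂ] B) : coe (s * t) = coe s * coe t :=
  Completion.coe_mul (AlgTensor.equiv s) (AlgTensor.equiv t)

theorem coe_one : coe (1 : A ⊗[ℂ] B) = 1 := Completion.coe_one (AlgTensor A B)

theorem coe_smul (r : ℂ) (t : A ⊗[ℂ] B) : coe (r • t) = r • coe t :=
  Completion.coe_smul r (AlgTensor.equiv t)

/-- The adjoint, extended by continuity. -/
noncomputable instance : Star (SpatialTensor A B) :=
  ⟨(Completion.map star : Completion (AlgTensor A B) → Completion (AlgTensor A B))⟩

theorem star_coe (t : A ⊗[ℂ] B) : star (coe t) = coe (star t) :=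
  Completion.map_coe (star_isometry (E := AlgTensor A B)).uniformContinuous (AlgTensor.equiv t)

theorem continuous_star' : Continuous (star : SpatialTensor A B → SpatialTensor A B) :=
  Completion.continuous_map (f := (star : AlgTensor A B → AlgTensor A B))

instance : ContinuousStar (SpatialTensor A B) := ⟨continuous_star'⟩

noncomputable instance : StarRing (SpatialTensor A B) where
  star_involutive x := by
    induction x using SpatialTensor.induction with
    | hp => apply isClosed_eq <;> fun_prop
    | ih t => rw [star_coe, star_coe, star_star]
  star_mul x y := by
    induction x using SpatialTensor.induction with
    | hp => apply isClosed_eq <;> fun_prop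
    | ih s =>
      induction y using SpatialTensor.induction with
      | hp => apply isClosed_eq <;> fun_prop
      | ih t => rw [← coe_mul, star_coe, star_coe, star_coe, star_mul, coe_mul]
  star_add x y := by
    induction x using SpatialTensor.induction with
    | hp => apply isClosed_eq <;> fun_prop
    | ih s =>
      induction y using SpatialTensor.induction with
      | hp => apply isClosed_eq <;> fun_prop
      | ih t => rw [← coe_add, star_coe, star_coe, star_coe, star_add, coe_add]

theorem star_smul' (r : ℂ) (x : SpatialTensor A B) : star (r • x) = star r • star x := by
  induction x using SpatialTensor.induction with
  | hp =>
    have h₁ : Continuous fun x : SpatialTensor A B => r • x := continuous_const_smul r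
    have h₂ : Continuous fun x : SpatialTensor A B => star r • x := continuous_const_smul (star r)
    exact isClosed_eq (continuous_star'.comp h₁) (h₂.comp continuous_star')
  | ih t =>
    have h : star (r • t) = star r • star t := star_smul r t
    rw [← coe_smul, star_coe, star_coe, h, coe_smul]

noncomputable instance : CStarAlgebra (SpatialTensor A B) where
  norm_mul_self_le x := by
    induction x using SpatialTensor.induction with
    | hp => apply isClosed_le <;> fun_prop
    | ih t =>
      rw [star_coe, ← coe_mul, norm_coe, norm_coe]
      exact AlgTensor.norm_star_mul_self' (AlgTensor.equiv t)
  star_smul := star_smul'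

/-- The canonical `*`-homomorphism of the algebraic tensor product into the spatial one. -/
noncomputable def of : A ⊗[ℂ] B →⋆ₐ[ℂ] SpatialTensor A B where
  toFun := coe
  map_one' := coe_one
  map_mul' := coe_mul
  map_zero' := by simpa using coe_smul (0 : ℂ) (0 : A ⊗[ℂ] B)
  map_add' := coe_add
  commutes' r := by
    rw [Algebra.algebraMap_eq_smul_one, coe_smul, coe_one, Algebra.algebraMap_eq_smul_one]
  map_star' t := (star_coe t).symm

/-- The elementary tensor `a ⊗ b`. -/
noncomputable def tmul (a : A) (b : B) : SpatialTensor A B := of (a ⊗ₜ[ℂ] b)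

/-- The extension by continuity of a `*`-homomorphism on the algebraic tensor product that is
contractive for the spatial norm. -/
noncomputable def lift {D : Type*} [CStarAlgebra D] (Φ : A ⊗[ℂ] B →⋆ₐ[ℂ] D)
    (h : ∀ t, ‖Φ t‖ ≤ spatialNorm t) : SpatialTensor A B →⋆ₐ[ℂ] D :=
  let L : AlgTensor A B →L[ℂ] D :=
    LinearMap.mkContinuous
      (Φ.toAlgHom.toLinearMap ∘ₗ (AlgTensor.equiv (A := A) (B := B)).symm.toAlgEquiv.toLinearMap)
      1 (fun t => by rw [one_mul]; exact h _)
  let F : SpatialTensor A B → D := (Completion.extension L : Completion (AlgTensor A B) → D)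
  have hF : ∀ t, F (coe t) = Φ t := fun t =>
    Completion.extension_coe L.uniformContinuous (AlgTensor.equiv t)
  have hc : Continuous F := Completion.continuous_extension (f := L)
  { toFun := F
    map_one' := by rw [← coe_one, hF, map_one]
    map_zero' := by
      have : (0 : SpatialTensor A B) = coe 0 := (map_zero of).symm
      rw [this, hF, map_zero]
    map_mul' := fun x y => by
      induction x using SpatialTensor.induction with
      | hp => apply isClosed_eq <;> fun_prop
      | ih s =>
        induction y using SpatialTensor.induction with
        | hp => apply isClosed_eq <;> fun_prop
        | ih t => rw [← coe_mul, hF, hF, hF, map_mul]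
    map_add' := fun x y => by
      induction x using SpatialTensor.induction with
      | hp => apply isClosed_eq <;> fun_prop
      | ih s =>
        induction y using SpatialTensor.induction with
        | hp => apply isClosed_eq <;> fun_prop
        | ih t => rw [← coe_add, hF, hF, hF, map_add]
    commutes' := fun r => by
      rw [Algebra.algebraMap_eq_smul_one, ← coe_one, ← coe_smul, hF, map_smul, map_one,
        Algebra.algebraMap_eq_smul_one]
    map_star' := fun x => by
      induction x using SpatialTensor.induction with
      | hp => apply isClosed_eq <;> fun_prop
      | ih t => rw [star_coe, hF, hF, map_star] }

theorem lift_of {D : Type*} [CStarAlgebra D] (Φ : A ⊗[ℂ] B →⋆ₐ[ℂ] D)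
    (h : ∀ t, ‖Φ t‖ ≤ spatialNorm t) (t : A ⊗[ℂ] B) : lift Φ h (of t) = Φ t :=
  Completion.extension_coe (f := LinearMap.mkContinuous
      (Φ.toAlgHom.toLinearMap ∘ₗ (AlgTensor.equiv (A := A) (B := B)).symm.toAlgEquiv.toLinearMap)
      1 (fun t => by rw [one_mul]; exact h _)) (ContinuousLinearMap.uniformContinuous _)
      (AlgTensor.equiv t)


/-- The representation `ρ ⊗ σ` of the spatial tensor product on the Hilbert space tensor product. -/
noncomputable def prodRep (ρ : Rep A) (σ : Rep B) : Rep (SpatialTensor A B) where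
  H := HilbertTensor ρ.H σ.H
  hom := lift (algProdRep ρ.hom σ.hom) fun t => norm_algProdRep_le t ρ σ

theorem prodRep_of (ρ : Rep A) (σ : Rep B) (t : A ⊗[ℂ] B) :
    (prodRep ρ σ).hom (of t) = algProdRep ρ.hom σ.hom t :=
  lift_of _ (fun t => norm_algProdRep_le t ρ σ) t

/-- The `*`-homomorphism `a ⊗ b ↦ f a * g b` on the algebraic tensor product, for unital
`*`-homomorphisms `f` and `g` with commuting ranges. -/
noncomputable def algLift {D : Type*} [CStarAlgebra D] (f : A →⋆ₐ[ℂ] D) (g : B →⋆ₐ[ℂ] D)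
    (h : ∀ a b, Commute (f a) (g b)) : A ⊗[ℂ] B →⋆ₐ[ℂ] D where
  __ := Algebra.TensorProduct.lift f.toAlgHom g.toAlgHom h
  map_star' x := by
    change Algebra.TensorProduct.lift f.toAlgHom g.toAlgHom h (star x) =
      star (Algebra.TensorProduct.lift f.toAlgHom g.toAlgHom h x)
    induction x using TensorProduct.induction_on with
    | zero => rw [star_zero, map_zero, star_zero]
    | add x y hx hy => rw [star_add, map_add, map_add, hx, hy, star_add]
    | tmul a b =>
      rw [TensorProduct.star_tmul, Algebra.TensorProduct.lift_tmul,
        Algebra.TensorProduct.lift_tmul, star_mul]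
      change f (star a) * g (star b) = star (g b) * star (f a)
      rw [← map_star, ← map_star]
      exact h _ _

theorem algLift_tmul {D : Type*} [CStarAlgebra D] (f : A →⋆ₐ[ℂ] D) (g : B →⋆ₐ[ℂ] D)
    (h : ∀ a b, Commute (f a) (g b)) (a : A) (b : B) : algLift f g h (a ⊗ₜ b) = f a * g b :=
  Algebra.TensorProduct.lift_tmul f.toAlgHom g.toAlgHom h a b

theorem tmul_mul_tmul (a a' : A) (b b' : B) :
    tmul a b * tmul a' b' = tmul (a * a') (b * b') := by
  rw [tmul, tmul, tmul, ← map_mul, Algebra.TensorProduct.tmul_mul_tmul]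

/-- The embedding `a ↦ a ⊗ I`. -/
noncomputable def inl : A →⋆ₐ[ℂ] SpatialTensor A B where
  __ := (of (A := A) (B := B)).toAlgHom.comp Algebra.TensorProduct.includeLeft
  map_star' a := by
    change of (star a ⊗ₜ[ℂ] (1 : B)) = star (of (a ⊗ₜ[ℂ] (1 : B)))
    rw [← map_star, TensorProduct.star_tmul, star_one]

/-- The embedding `b ↦ I ⊗ b`. -/
noncomputable def inr : B →⋆ₐ[ℂ] SpatialTensor A B where
  __ := (of (A := A) (B := B)).toAlgHom.comp Algebra.TensorProduct.includeRight
  map_star' b := by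
    change of ((1 : A) ⊗ₜ[ℂ] star b) = star (of ((1 : A) ⊗ₜ[ℂ] b))
    rw [← map_star, TensorProduct.star_tmul, star_one]

theorem inl_apply (a : A) : (inl a : SpatialTensor A B) = tmul a 1 := rfl

theorem inr_apply (b : B) : (inr b : SpatialTensor A B) = tmul 1 b := rfl

section Map

variable {A' B' : Type u} [CStarAlgebra A'] [CStarAlgebra B']
  (f : A →⋆ₐ[ℂ] A') (g : B →⋆ₐ[ℂ] B')

theorem commute_inl_inr (a : A) (b : B) :
    Commute (inl a : SpatialTensor A B) (inr b : SpatialTensor A B) := by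
  rw [Commute, SemiconjBy, inl_apply, inr_apply, tmul_mul_tmul, tmul_mul_tmul]
  simp

theorem commute_comp (a : A) (b : B) :
    Commute ((inl.comp f : A →⋆ₐ[ℂ] SpatialTensor A' B') a)
      ((inr.comp g : B →⋆ₐ[ℂ] SpatialTensor A' B') b) :=
  commute_inl_inr (f a) (g b)

theorem algLift_eq_of_map (t : A ⊗[ℂ] B) :
    algLift (inl.comp f) (inr.comp g) (commute_comp f g) t =
      (of (TensorProduct.map f.toAlgHom.toLinearMap g.toAlgHom.toLinearMap t) :
        SpatialTensor A' B') := by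
  induction t using TensorProduct.induction_on with
  | zero => simp
  | add x y hx hy => rw [map_add, hx, hy, map_add, map_add]
  | tmul a b =>
    rw [algLift_tmul, StarAlgHom.comp_apply, StarAlgHom.comp_apply, inl_apply, inr_apply,
      tmul_mul_tmul, mul_one, one_mul]
    rfl

/-- Pull-back of a representation along a unital `*`-homomorphism. -/
noncomputable def _root_.CQG.Rep.comp (ρ : Rep A') (f : A →⋆ₐ[ℂ] A') : Rep A :=
  ⟨ρ.H, ρ.hom.comp f⟩

theorem algProdRep_map (ρ : Rep A') (σ : Rep B') (t : A ⊗[ℂ] B) :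
    algProdRep ρ.hom σ.hom (TensorProduct.map f.toAlgHom.toLinearMap g.toAlgHom.toLinearMap t) =
      algProdRep (ρ.hom.comp f) (σ.hom.comp g) t := by
  induction t using TensorProduct.induction_on with
  | zero => simp
  | add x y hx hy => rw [map_add, map_add, hx, hy, map_add]
  | tmul a b => rfl

/-- The tensor product `f ⊗ g` of two unital `*`-homomorphisms. -/
noncomputable def map : SpatialTensor A B →⋆ₐ[ℂ] SpatialTensor A' B' :=
  lift (algLift (inl.comp f) (inr.comp g) (commute_comp f g)) fun t => by
    rw [algLift_eq_of_map]
    refine (norm_coe _).trans_le (spatialNorm_le _ fun ρ σ => ?_)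
    rw [algProdRep_map]
    exact norm_algProdRep_le t (ρ.comp f) (σ.comp g)

theorem map_tmul (a : A) (b : B) : map f g (tmul a b) = tmul (f a) (g b) := by
  rw [map, tmul, lift_of, algLift_eq_of_map]
  rfl

end Map

section Slice

/-- The scalar representation `a ↦ χ a • I`. -/
noncomputable def scalarHom (χ : A →⋆ₐ[ℂ] ℂ) (D : Type*) [CStarAlgebra D] : A →⋆ₐ[ℂ] D :=
  (StarAlgHom.ofId ℂ D).comp χ

theorem scalarHom_apply (χ : A →⋆ₐ[ℂ] ℂ) (D : Type*) [CStarAlgebra D] (a : A) :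
    scalarHom χ D a = χ a • (1 : D) :=
  Algebra.algebraMap_eq_smul_one (χ a)

theorem starId_apply (a : A) : StarAlgHom.id ℂ A a = a := rfl

theorem commute_scalarHom (χ : A →⋆ₐ[ℂ] ℂ) (a : A) (b : B) :
    Commute (scalarHom χ B a) (StarAlgHom.id ℂ B b) :=
  Algebra.commutes (χ a) b

theorem norm_le_norm_opTensor_one_left {H : Type u} [NormedAddCommGroup H]
    [InnerProductSpace ℂ H] (S : H →L[ℂ] H) : ‖S‖ ≤ ‖opTensor (1 : H →L[ℂ] H) S‖ := by
  refine ContinuousLinearMap.opNorm_le_bound _ (norm_nonneg _) fun ξ => ?_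
  rcases eq_or_ne ξ 0 with rfl | hξ
  · simp
  have h := (opTensor (1 : H →L[ℂ] H) S).le_opNorm (toHilbert (ξ ⊗ₜ[ℂ] ξ))
  rw [opTensor_coe, LinearIsometry.norm_map, LinearIsometry.norm_map, TensorProduct.mapL_tmul,
    TensorProduct.norm_tmul, TensorProduct.norm_tmul, one_apply_eq_self] at h
  have := norm_pos_iff.mpr hξ
  nlinarith

theorem norm_le_norm_opTensor_one_right {H : Type u} [NormedAddCommGroup H]
    [InnerProductSpace ℂ H] (S : H →L[ℂ] H) : ‖S‖ ≤ ‖opTensor S (1 : H →L[ℂ] H)‖ := by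
  refine ContinuousLinearMap.opNorm_le_bound _ (norm_nonneg _) fun ξ => ?_
  rcases eq_or_ne ξ 0 with rfl | hξ
  · simp
  have h := (opTensor S (1 : H →L[ℂ] H)).le_opNorm (toHilbert (ξ ⊗ₜ[ℂ] ξ))
  rw [opTensor_coe, LinearIsometry.norm_map, LinearIsometry.norm_map, TensorProduct.mapL_tmul,
    TensorProduct.norm_tmul, TensorProduct.norm_tmul, one_apply_eq_self] at h
  have := norm_pos_iff.mpr hξ
  nlinarith

theorem algProdRep_scalar_left (χ : A →⋆ₐ[ℂ] ℂ) (t : A ⊗[ℂ] B) (ρ : Rep B) :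
    algProdRep (scalarHom χ (ρ.H →L[ℂ] ρ.H)) ρ.hom t =
      opTensor 1 (ρ.hom (algLift (scalarHom χ B) (StarAlgHom.id ℂ B) (commute_scalarHom χ) t)) := by
  induction t using TensorProduct.induction_on with
  | zero => simpa using (opTensor_smul_right (0 : ℂ) (1 : ρ.H →L[ℂ] ρ.H) (0 : ρ.H →L[ℂ] ρ.H)).symm
  | add x y hx hy => rw [map_add, hx, hy, map_add, map_add, opTensor_add_right]
  | tmul a b =>
    rw [algProdRep_tmul, algLift_tmul, scalarHom_apply, scalarHom_apply, starId_apply,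
      smul_one_mul, map_smul, opTensor_smul_right, opTensor_smul_left]

/-- The slice map `χ ⊗ ι`, `a ⊗ b ↦ χ a • b`. -/
noncomputable def sliceLeft (χ : A →⋆ₐ[ℂ] ℂ) : SpatialTensor A B →⋆ₐ[ℂ] B :=
  lift (algLift (scalarHom χ B) (StarAlgHom.id ℂ B) (commute_scalarHom χ)) fun t => by
    obtain ⟨ρ, hρ⟩ := exists_rep_norm_le
      (algLift (scalarHom χ B) (StarAlgHom.id ℂ B) (commute_scalarHom χ) t)
    refine hρ.trans ((norm_le_norm_opTensor_one_left _).trans ?_)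
    rw [← algProdRep_scalar_left]
    exact norm_algProdRep_le t ⟨ρ.H, scalarHom χ (ρ.H →L[ℂ] ρ.H)⟩ ρ

theorem sliceLeft_tmul (χ : A →⋆ₐ[ℂ] ℂ) (a : A) (b : B) : sliceLeft χ (tmul a b) = χ a • b := by
  rw [sliceLeft, tmul, lift_of, algLift_tmul, scalarHom_apply, starId_apply, smul_one_mul]

theorem algProdRep_scalar_right (χ : B →⋆ₐ[ℂ] ℂ) (t : A ⊗[ℂ] B) (ρ : Rep A) :
    algProdRep ρ.hom (scalarHom χ (ρ.H →L[ℂ] ρ.H)) t =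
      opTensor (ρ.hom (algLift (StarAlgHom.id ℂ A) (scalarHom χ A)
        (fun a b => (commute_scalarHom χ b a).symm) t)) 1 := by
  induction t using TensorProduct.induction_on with
  | zero => simpa using (opTensor_smul_left (0 : ℂ) (0 : ρ.H →L[ℂ] ρ.H) (1 : ρ.H →L[ℂ] ρ.H)).symm
  | add x y hx hy => rw [map_add, hx, hy, map_add, map_add, opTensor_add_left]
  | tmul a b =>
    rw [algProdRep_tmul, algLift_tmul, scalarHom_apply, scalarHom_apply, starId_apply,
      mul_smul_one, map_smul, opTensor_smul_left, opTensor_smul_right]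

/-- The slice map `ι ⊗ χ`, `a ⊗ b ↦ χ b • a`. -/
noncomputable def sliceRight (χ : B →⋆ₐ[ℂ] ℂ) : SpatialTensor A B →⋆ₐ[ℂ] A :=
  lift (algLift (StarAlgHom.id ℂ A) (scalarHom χ A)
    (fun a b => (commute_scalarHom χ b a).symm)) fun t => by
    obtain ⟨ρ, hρ⟩ := exists_rep_norm_le (algLift (StarAlgHom.id ℂ A) (scalarHom χ A)
      (fun a b => (commute_scalarHom χ b a).symm) t)
    refine hρ.trans ((norm_le_norm_opTensor_one_right _).trans ?_)
    rw [← algProdRep_scalar_right]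
    exact norm_algProdRep_le t ρ ⟨ρ.H, scalarHom χ (ρ.H →L[ℂ] ρ.H)⟩

theorem sliceRight_tmul (χ : B →⋆ₐ[ℂ] ℂ) (a : A) (b : B) : sliceRight χ (tmul a b) = χ b • a := by
  rw [sliceRight, tmul, lift_of, algLift_tmul, scalarHom_apply, starId_apply, mul_smul_one]

end Slice

end SpatialTensor

open SpatialTensor

/-- The canonical identification `(A ⊗ B) ⊗ C = A ⊗ (B ⊗ C)`, as a relation: `x` and `y` correspond
to each other if, for all representations `ρ`, `σ`, `τ` of `A`, `B`, `C` on Hilbert spaces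
`H`, `K`, `L`, the operators `((ρ ⊗ σ) ⊗ τ) x` and `(ρ ⊗ (σ ⊗ τ)) y` agree as operators on
`H ⊗ K ⊗ L`, which means that they have the same matrix coefficients between elementary tensors. -/
def SpatialTensor.AssocEq {A B C : Type u} [CStarAlgebra A] [CStarAlgebra B] [CStarAlgebra C]
    (x : SpatialTensor (SpatialTensor A B) C) (y : SpatialTensor A (SpatialTensor B C)) : Prop :=
  ∀ (ρ : Rep A) (σ : Rep B) (τ : Rep C) (h h' : ρ.H) (k k' : σ.H) (l l' : τ.H),
    ⟪toHilbert (toHilbert (h ⊗ₜ[ℂ] k) ⊗ₜ[ℂ] l), (prodRep (prodRep ρ σ) τ).hom x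
        (toHilbert (toHilbert (h' ⊗ₜ[ℂ] k') ⊗ₜ[ℂ] l'))⟫_ℂ =
      ⟪toHilbert (h ⊗ₜ[ℂ] toHilbert (k ⊗ₜ[ℂ] l)), (prodRep ρ (prodRep σ τ)).hom y
        (toHilbert (h' ⊗ₜ[ℂ] toHilbert (k' ⊗ₜ[ℂ] l')))⟫_ℂ

section QuantumGroups

variable {A A' C : Type u} [CStarAlgebra A] [CStarAlgebra A'] [CStarAlgebra C]

/-- `(A, Δ)` is a compact quantum group. -/
structure IsCompactQuantumGroup (Δ : A →⋆ₐ[ℂ] SpatialTensor A A) : Prop where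
  coassoc : ∀ a, AssocEq (map Δ (StarAlgHom.id ℂ A) (Δ a)) (map (StarAlgHom.id ℂ A) Δ (Δ a))
  dense_left : Dense
    (Submodule.span ℂ {x : SpatialTensor A A | ∃ b c, x = tmul b 1 * Δ c} :
      Set (SpatialTensor A A))
  dense_right : Dense
    (Submodule.span ℂ {x : SpatialTensor A A | ∃ b c, x = tmul 1 b * Δ c} :
      Set (SpatialTensor A A))

/-- `(A', Δ')` is a compact quantum subgroup of `(A, Δ)` through `π`. -/
structure IsQuantumSubgroup (Δ : A →⋆ₐ[ℂ] SpatialTensor A A) (Δ' : A' →⋆ₐ[ℂ] SpatialTensor A' A')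
    (π : A →⋆ₐ[ℂ] A') : Prop where
  surjective : Function.Surjective π
  map_comul : ∀ a, map π π (Δ a) = Δ' (π a)

/-- `δ` is an action of `(A, Δ)` on `C`. -/
def IsAction (Δ : A →⋆ₐ[ℂ] SpatialTensor A A) (δ : C →⋆ₐ[ℂ] SpatialTensor C A) : Prop :=
  ∀ c, AssocEq (map δ (StarAlgHom.id ℂ A) (δ c)) (map (StarAlgHom.id ℂ C) Δ (δ c))

/-- `e` is an everywhere defined counit of `(A, Δ)`: a character of `A` with `(ι ⊗ e) ∘ Δ = ι`. -/
def IsCounit (Δ : A →⋆ₐ[ℂ] SpatialTensor A A) (e : A →⋆ₐ[ℂ] ℂ) : Prop :=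
  ∀ a, sliceRight e (Δ a) = a

/-- The opposite action `(π ⊗ ι) ∘ Δ` on `A` of the quantum subgroup defined by `π`. -/
noncomputable def oppositeAction (Δ : A →⋆ₐ[ℂ] SpatialTensor A A) (π : A →⋆ₐ[ℂ] A') :
    A →⋆ₐ[ℂ] SpatialTensor A' A :=
  (map π (StarAlgHom.id ℂ A)).comp Δ

/-- The quantum right coset space of the quantum subgroup defined by `π`: the algebra of all `a`
with `(π ⊗ ι) (Δ a) = I ⊗ a`. -/
noncomputable def rightCosetSpace (Δ : A →⋆ₐ[ℂ] SpatialTensor A A) (π : A →⋆ₐ[ℂ] A') :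
    StarSubalgebra ℂ A :=
  StarAlgHom.equalizer (oppositeAction Δ π) inr

instance isClosed_rightCosetSpace (Δ : A →⋆ₐ[ℂ] SpatialTensor A A) (π : A →⋆ₐ[ℂ] A') :
    IsClosed (rightCosetSpace Δ π : Set A) :=
  isClosed_eq
    (AddMonoidHomClass.continuous_of_bound (oppositeAction Δ π) 1 fun a => by
      rw [one_mul]; exact NonUnitalStarAlgHom.norm_apply_le _ a)
    (AddMonoidHomClass.continuous_of_bound (inr (A := A') (B := A)) 1 fun a => by
      rw [one_mul]; exact NonUnitalStarAlgHom.norm_apply_le _ a)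

noncomputable instance (Δ : A →⋆ₐ[ℂ] SpatialTensor A A) (π : A →⋆ₐ[ℂ] A') :
    CStarAlgebra (rightCosetSpace Δ π) :=
  StarSubalgebra.cstarAlgebra (rightCosetSpace Δ π)

/-- A character of a `C*`-algebra, as a unital `*`-homomorphism. -/
noncomputable def charHom (χ : WeakDual.characterSpace ℂ C) : C →⋆ₐ[ℂ] ℂ where
  __ := WeakDual.CharacterSpace.toAlgHom χ
  map_star' := map_star χ

/-- The map `T_χ = (χ ⊗ ι) ∘ δ`. -/
noncomputable def orbitMap (δ : C →⋆ₐ[ℂ] SpatialTensor C A) (χ : WeakDual.characterSpace ℂ C) :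
    C →⋆ₐ[ℂ] A :=
  (sliceLeft (charHom χ)).comp δ

/-- The closed two-sided ideal of `A` generated by the elements `(χ ⊗ ι) (δ c) - χ c • I`. -/
def stabilizerIdeal (δ : C →⋆ₐ[ℂ] SpatialTensor C A) (χ : WeakDual.characterSpace ℂ C) : Set A :=
  closure (TwoSidedIdeal.span (Set.range fun c => orbitMap δ χ c - χ c • (1 : A)) : Set A)

end QuantumGroups

end CQG

/-!
Slicing the associativity of the action by `χ` gives `Δ ∘ T_χ = (T_χ ⊗ ι) ∘ δ`. Modulo the closed
ideal generated by the elements `T_χ(c) - χ(c) I`, the first leg of the right-hand side collapses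
to the scalars `χ(c)`, so that `Δ (T_χ(c))` becomes `I ⊗ T_χ(c)`. Projecting the second leg as well,
`Δ` descends to the quotient of `A` by this ideal, and without that projection the same formula puts
`T_χ(c)` in the right coset space. The quotient is a `C*`-algebra because `I ∩ I*` has an
approximate unit of self-adjoint contractions, which computes the quotient norm.

Associativity is given through matrix coefficients of product representations, which separate the
elements of a spatial tensor product. It can be sliced because a character is itself a
one-dimensional representation, whose only matrix coefficient is the character.

If `δ` is injective and `e` is a counit, slicing the associativity by `e` gives
`δ ∘ (ι ⊗ e) ∘ δ = δ`, hence `(ι ⊗ e) ∘ δ = ι`, and applying `χ` gives `e ∘ T_χ = χ`.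
-/

namespace CQG

open scoped TensorProduct InnerProductSpace CStarAlgebra

section ClosedIdeals

theorem norm_mul_one_sub_mul_self_le {R : Type*} [NormedRing R] [StarRing R] [CStarRing R] {e : R}
    (he : IsSelfAdjoint e) (he1 : ‖1 - e‖ ≤ 1) (a : R) :
    ‖a * (1 - e)‖ * ‖a * (1 - e)‖ ≤ ‖star a * a * (1 - e)‖ :=
  calc ‖a * (1 - e)‖ * ‖a * (1 - e)‖ = ‖star (a * (1 - e)) * (a * (1 - e))‖ :=
        CStarRing.norm_star_mul_self.symm
    _ = ‖(1 - e) * (star a * a * (1 - e))‖ := by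
        rw [star_mul, star_sub, star_one, he.star_eq]; noncomm_ring
    _ ≤ ‖1 - e‖ * ‖star a * a * (1 - e)‖ := norm_mul_le _ _
    _ ≤ ‖star a * a * (1 - e)‖ := mul_le_of_le_one_left (norm_nonneg _) he1

variable {A : Type*} [CStarAlgebra A]

theorem exists_isSelfAdjoint_norm_mul_one_sub_lt (S : NonUnitalStarSubalgebra ℂ A)
    [IsClosed (S : Set A)] {a : A} (ha : a ∈ S) {ε : ℝ} (hε : 0 < ε) :
    ∃ e ∈ S, IsSelfAdjoint e ∧ ‖1 - e‖ ≤ 1 ∧ ‖a * (1 - e)‖ < ε := by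
  let _ : NonUnitalCStarAlgebra S := NonUnitalStarSubalgebra.nonUnitalCStarAlgebra S
  let _ : PartialOrder S := CStarAlgebra.spectralOrder S
  have _ : StarOrderedRing S := CStarAlgebra.spectralOrderedRing S
  let _ : PartialOrder A := CStarAlgebra.spectralOrder A
  have _ : StarOrderedRing A := CStarAlgebra.spectralOrderedRing A
  have hunit := CStarAlgebra.increasingApproximateUnit S
  have htendsto := (hunit.tendsto_mul_left ⟨a, ha⟩).eventually (Metric.ball_mem_nhds _ hε)
  obtain ⟨e, hae, he0, he1⟩ :=
    (htendsto.and (hunit.eventually_nonneg.and hunit.eventually_norm)).exists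
  have hpos : (0 : A) ≤ e := by
    obtain ⟨b, rfl⟩ := CStarAlgebra.nonneg_iff_eq_star_mul_self.mp he0
    exact star_mul_self_nonneg (b : A)
  have hle : (e : A) ≤ 1 := (CStarAlgebra.norm_le_one_iff_of_nonneg _ hpos).mp he1
  refine ⟨e, e.2, .of_nonneg hpos, ?_, ?_⟩
  · exact (CStarAlgebra.norm_le_one_iff_of_nonneg _ (sub_nonneg.mpr hle)).mpr (sub_le_self _ hpos)
  · rw [dist_eq_norm] at hae
    rw [mul_sub, mul_one, norm_sub_rev]
    exact hae

/-- The intersection of a left ideal with its adjoint, as a `*`-algebra: an approximate unit of it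
is a right approximate unit of the ideal. -/
def starInvariantPart (I : Ideal A) : NonUnitalStarSubalgebra ℂ A where
  carrier := {a | a ∈ I ∧ star a ∈ I}
  add_mem' ha hb := ⟨I.add_mem ha.1 hb.1, by rw [star_add]; exact I.add_mem ha.2 hb.2⟩
  zero_mem' := ⟨I.zero_mem, by rw [star_zero]; exact I.zero_mem⟩
  mul_mem' ha hb := ⟨I.mul_mem_left _ hb.1, by rw [star_mul]; exact I.mul_mem_left _ ha.2⟩
  smul_mem' r _ ha :=
    ⟨I.smul_of_tower_mem r ha.1, by rw [star_smul]; exact I.smul_of_tower_mem _ ha.2⟩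
  star_mem' ha := ⟨ha.2, by rw [star_star]; exact ha.1⟩

variable (I : Ideal A) [IsClosed (I : Set A)]

instance isClosed_starInvariantPart : IsClosed (starInvariantPart I : Set A) :=
  have hI : IsClosed (I : Set A) := inferInstance
  hI.inter (hI.preimage continuous_star)

theorem exists_mem_ideal_norm_mul_one_sub_lt {a : A} (ha : a ∈ I) {ε : ℝ} (hε : 0 < ε) :
    ∃ e ∈ I, IsSelfAdjoint e ∧ ‖1 - e‖ ≤ 1 ∧ ‖a * (1 - e)‖ < ε := by
  have hmem : star a * a ∈ starInvariantPart I :=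
    ⟨I.mul_mem_left _ ha, by rw [star_mul, star_star]; exact I.mul_mem_left _ ha⟩
  obtain ⟨e, he, hes, he1, hae⟩ :=
    exists_isSelfAdjoint_norm_mul_one_sub_lt (starInvariantPart I) hmem (mul_pos hε hε)
  exact ⟨e, he.1, hes, he1, lt_of_mul_self_lt_mul_self₀ hε.le
    ((norm_mul_one_sub_mul_self_le hes he1 a).trans_lt hae)⟩

theorem star_mem_of_isClosed [I.IsTwoSided] {a : A} (ha : a ∈ I) : star a ∈ I := by
  have hI : IsClosed (I : Set A) := inferInstance
  refine hI.closure_subset (Metric.mem_closure_iff.mpr fun ε hε => ?_)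
  obtain ⟨e, he, hes, -, hae⟩ := exists_mem_ideal_norm_mul_one_sub_lt I ha hε
  refine ⟨e * star a, I.mul_mem_right _ he, ?_⟩
  have hstar : star (a * (1 - e)) = star a - e * star a := by
    rw [star_mul, star_sub, star_one, hes.star_eq, sub_mul, one_mul]
  rwa [dist_eq_norm, ← hstar, norm_star]

theorem exists_mem_ideal_norm_mul_one_sub_lt_of_norm_mk_lt {a : A} {r : ℝ}
    (hr : ‖Submodule.Quotient.mk (p := I) a‖ < r) :
    ∃ e ∈ I, IsSelfAdjoint e ∧ ‖1 - e‖ ≤ 1 ∧ ‖a * (1 - e)‖ < r := by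
  obtain ⟨b, hab, hb⟩ := QuotientAddGroup.norm_lt_iff.mp hr
  have hmem : a - b ∈ I := (Submodule.Quotient.eq I).mp hab.symm
  obtain ⟨e, he, hes, he1, hae⟩ :=
    exists_mem_ideal_norm_mul_one_sub_lt I hmem (sub_pos.mpr hb)
  refine ⟨e, he, hes, he1, ?_⟩
  calc ‖a * (1 - e)‖ = ‖b * (1 - e) + (a - b) * (1 - e)‖ := by rw [← add_mul, add_sub_cancel]
    _ ≤ ‖b‖ * ‖1 - e‖ + ‖(a - b) * (1 - e)‖ := norm_add_le_of_le (norm_mul_le _ _) le_rfl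
    _ < ‖b‖ + (r - ‖b‖) := add_lt_add_of_le_of_lt (mul_le_of_le_one_right (norm_nonneg b) he1) hae
    _ = r := add_sub_cancel _ _

theorem norm_mk_mul_self_le (a : A) :
    ‖Submodule.Quotient.mk (p := I) a‖ * ‖Submodule.Quotient.mk (p := I) a‖ ≤
      ‖Submodule.Quotient.mk (p := I) (star a * a)‖ := by
  refine le_of_forall_gt fun r hr => ?_
  obtain ⟨e, he, hes, he1, hae⟩ := exists_mem_ideal_norm_mul_one_sub_lt_of_norm_mk_lt I hr
  have hmk : Submodule.Quotient.mk (p := I) a = Submodule.Quotient.mk (a * (1 - e)) := by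
    rw [Submodule.Quotient.eq, mul_sub, mul_one, sub_sub_cancel]
    exact I.mul_mem_left a he
  have hnorm : ‖Submodule.Quotient.mk (p := I) a‖ ≤ ‖a * (1 - e)‖ :=
    hmk ▸ Submodule.Quotient.norm_mk_le I _
  calc _ ≤ ‖a * (1 - e)‖ * ‖a * (1 - e)‖ := mul_self_le_mul_self (norm_nonneg _) hnorm
    _ ≤ ‖star a * a * (1 - e)‖ := norm_mul_one_sub_mul_self_le hes he1 a
    _ < r := hae

end ClosedIdeals

section Quotient

theorem norm_quotient_mul_le {R : Type*} [SeminormedRing R] (I : Ideal R) [I.IsTwoSided]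
    (x y : R ⧸ I) : ‖x * y‖ ≤ ‖x‖ * ‖y‖ := by
  refine le_mul_of_forall_lt₀ fun r hr s hs => ?_
  obtain ⟨a, rfl, ha⟩ := QuotientAddGroup.norm_lt_iff.mp hr
  obtain ⟨b, rfl, hb⟩ := QuotientAddGroup.norm_lt_iff.mp hs
  calc _ ≤ ‖a * b‖ := Submodule.Quotient.norm_mk_le I (a * b)
    _ ≤ ‖a‖ * ‖b‖ := norm_mul_le a b
    _ ≤ r * s := mul_le_mul ha.le hb.le (norm_nonneg b) ((norm_nonneg a).trans ha.le)

variable {A : Type*} [CStarAlgebra A] (I : Ideal A) [I.IsTwoSided] [IsClosed (I : Set A)]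

instance quotientStarRing : StarRing (A ⧸ I) where
  star := Quotient.map' star fun a b h => by
    rw [Submodule.quotientRel_def] at h ⊢
    rw [← star_sub]
    exact star_mem_of_isClosed I h
  star_involutive := Ideal.Quotient.mk_surjective.forall.mpr fun a =>
    congrArg (Ideal.Quotient.mk I) (star_star a)
  star_mul := Ideal.Quotient.mk_surjective.forall₂.mpr fun a b =>
    congrArg (Ideal.Quotient.mk I) (star_mul a b)
  star_add := Ideal.Quotient.mk_surjective.forall₂.mpr fun a b =>
    congrArg (Ideal.Quotient.mk I) (star_add a b)

noncomputable instance quotientCStarAlgebra : CStarAlgebra (A ⧸ I) where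
  __ := Submodule.Quotient.normedAddCommGroup I
  __ := Ideal.Quotient.ring I
  __ := quotientStarRing I
  __ := Submodule.Quotient.normedSpace I ℂ
  __ : Algebra ℂ (A ⧸ I) := Ideal.Quotient.algebra ℂ
  norm_mul_le := norm_quotient_mul_le I
  complete := (Submodule.Quotient.completeSpace I).complete
  norm_mul_self_le := Ideal.Quotient.mk_surjective.forall.mpr (norm_mk_mul_self_le I)
  star_smul r := Ideal.Quotient.mk_surjective.forall.mpr fun a =>
    congrArg (Ideal.Quotient.mk I) (star_smul r a)

/-- The quotient map `A → A ⧸ I` of a `C*`-algebra by a closed two-sided ideal. -/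
noncomputable def quotientMk : A →⋆ₐ[ℂ] A ⧸ I where
  __ := Ideal.Quotient.mkₐ ℂ I
  map_star' _ := rfl

variable {I}

theorem quotientMk_surjective : Function.Surjective (quotientMk I) := Ideal.Quotient.mk_surjective

theorem quotientMk_eq_zero_iff {a : A} : quotientMk I a = 0 ↔ a ∈ I :=
  Ideal.Quotient.eq_zero_iff_mem

/-- The factorization through `A ⧸ I` of a `*`-homomorphism that vanishes on `I`. -/
noncomputable def quotientLift {D : Type*} [CStarAlgebra D] (φ : A →⋆ₐ[ℂ] D)
    (hφ : ∀ a ∈ I, φ a = 0) : A ⧸ I →⋆ₐ[ℂ] D where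
  __ := Ideal.Quotient.liftₐ I φ.toAlgHom hφ
  map_star' := Ideal.Quotient.mk_surjective.forall.mpr (map_star φ)

theorem quotientLift_quotientMk {D : Type*} [CStarAlgebra D] (φ : A →⋆ₐ[ℂ] D)
    (hφ : ∀ a ∈ I, φ a = 0) (a : A) : quotientLift φ hφ (quotientMk I a) = φ a := rfl

end Quotient

section ClosedIdealSpan

variable {A : Type*} [CStarAlgebra A]

/-- The closed two-sided ideal generated by a set. -/
def closedIdealSpan (s : Set A) : Ideal A := (TwoSidedIdeal.asIdeal (.span s)).closure

instance isClosed_closedIdealSpan (s : Set A) : IsClosed (closedIdealSpan s : Set A) :=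
  isClosed_closure

instance isTwoSided_closedIdealSpan (s : Set A) : (closedIdealSpan s).IsTwoSided :=
  ⟨fun b ha => map_mem_closure (f := (· * b)) (by fun_prop) ha
    fun x hx => (TwoSidedIdeal.span s).mul_mem_right x b hx⟩

theorem forall_mem_closedIdealSpan_apply_eq_zero_iff {D : Type*} [CStarAlgebra D] {s : Set A}
    {φ : A →⋆ₐ[ℂ] D} : (∀ a ∈ closedIdealSpan s, φ a = 0) ↔ ∀ a ∈ s, φ a = 0 := by
  refine ⟨fun h a ha => h a (subset_closure (TwoSidedIdeal.subset_span ha)), fun h a ha => ?_⟩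
  have hker : TwoSidedIdeal.span s ≤ TwoSidedIdeal.ker φ :=
    TwoSidedIdeal.span_le.mpr fun x hx => (TwoSidedIdeal.mem_ker φ).mpr (h x hx)
  have hclosed : IsClosed {a | φ a = 0} := isClosed_eq (map_continuous φ) continuous_const
  exact closure_minimal (fun x hx => (TwoSidedIdeal.mem_ker φ).mp (hker hx)) hclosed ha

end ClosedIdealSpan

namespace SpatialTensor

variable {A A' A'' B B' B'' : Type u} [CStarAlgebra A] [CStarAlgebra A'] [CStarAlgebra A'']
  [CStarAlgebra B] [CStarAlgebra B'] [CStarAlgebra B'']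

section Ext

/-- A `*`-homomorphism as a continuous linear map. -/
def homCLM {A D : Type*} [CStarAlgebra A] [CStarAlgebra D] (f : A →⋆ₐ[ℂ] D) : A →L[ℂ] D where
  __ := f.toAlgHom.toLinearMap
  cont := map_continuous f

theorem homCLM_apply {A D : Type*} [CStarAlgebra A] [CStarAlgebra D] (f : A →⋆ₐ[ℂ] D) (a : A) :
    homCLM f a = f a := rfl

theorem continuousLinearMap_ext {E : Type*} [NormedAddCommGroup E] [NormedSpace ℂ E]
    {F G : SpatialTensor A B →L[ℂ] E} (h : ∀ a b, F (tmul a b) = G (tmul a b)) : F = G := by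
  have hof : F.toLinearMap ∘ₗ of.toAlgHom.toLinearMap = G.toLinearMap ∘ₗ of.toAlgHom.toLinearMap :=
    TensorProduct.ext' h
  exact ContinuousLinearMap.ext fun x =>
    isClosed_property denseRange_coe (isClosed_eq F.continuous G.continuous)
      (LinearMap.congr_fun hof) x

theorem starAlgHom_ext {D : Type*} [CStarAlgebra D] {f g : SpatialTensor A B →⋆ₐ[ℂ] D}
    (h : ∀ a b, f (tmul a b) = g (tmul a b)) : f = g :=
  StarAlgHom.ext fun x => DFunLike.congr_fun
    (continuousLinearMap_ext (F := homCLM f) (G := homCLM g) h) x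

theorem map_map (f : A →⋆ₐ[ℂ] A') (f' : A' →⋆ₐ[ℂ] A'') (g : B →⋆ₐ[ℂ] B') (g' : B' →⋆ₐ[ℂ] B'')
    (x : SpatialTensor A B) : map f' g' (map f g x) = map (f'.comp f) (g'.comp g) x := by
  have h : (map f' g').comp (map f g) = map (f'.comp f) (g'.comp g) :=
    starAlgHom_ext fun a b => by simp only [StarAlgHom.comp_apply, map_tmul]
  exact DFunLike.congr_fun h x

theorem map_id :
    map (StarAlgHom.id ℂ A) (StarAlgHom.id ℂ B) = StarAlgHom.id ℂ (SpatialTensor A B) :=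
  starAlgHom_ext fun a b => map_tmul _ _ a b

theorem map_of (f : A →⋆ₐ[ℂ] A') (g : B →⋆ₐ[ℂ] B') (t : A ⊗[ℂ] B) :
    map f g (of t) = of (TensorProduct.map f.toAlgHom.toLinearMap g.toAlgHom.toLinearMap t) := by
  rw [map, lift_of, algLift_eq_of_map]

theorem denseRange_map {f : A →⋆ₐ[ℂ] A'} {g : B →⋆ₐ[ℂ] B'} (hf : Function.Surjective f)
    (hg : Function.Surjective g) : DenseRange (map f g) := by
  refine denseRange_coe.mono (Set.range_subset_iff.mpr fun t => ?_)
  obtain ⟨s, rfl⟩ := TensorProduct.map_surjective (g := f.toAlgHom.toLinearMap)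
    (g' := g.toAlgHom.toLinearMap) hf hg t
  exact ⟨of s, map_of f g s⟩

end Ext

section Slice

theorem sliceLeft_map (χ : A' →⋆ₐ[ℂ] ℂ) (f : A →⋆ₐ[ℂ] A') (g : B →⋆ₐ[ℂ] B')
    (x : SpatialTensor A B) : sliceLeft χ (map f g x) = g (sliceLeft (χ.comp f) x) := by
  have h : (sliceLeft χ).comp (map f g) = g.comp (sliceLeft (χ.comp f)) :=
    starAlgHom_ext fun a b => by
      simp only [StarAlgHom.comp_apply, map_tmul, sliceLeft_tmul, map_smul]
  exact DFunLike.congr_fun h x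

theorem sliceRight_map (χ : B' →⋆ₐ[ℂ] ℂ) (f : A →⋆ₐ[ℂ] A') (g : B →⋆ₐ[ℂ] B')
    (x : SpatialTensor A B) : sliceRight χ (map f g x) = f (sliceRight (χ.comp g) x) := by
  have h : (sliceRight χ).comp (map f g) = f.comp (sliceRight (χ.comp g)) :=
    starAlgHom_ext fun a b => by
      simp only [StarAlgHom.comp_apply, map_tmul, sliceRight_tmul, map_smul]
  exact DFunLike.congr_fun h x

theorem apply_sliceLeft (χ : A →⋆ₐ[ℂ] ℂ) (ψ : B →⋆ₐ[ℂ] ℂ) (x : SpatialTensor A B) :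
    ψ (sliceLeft χ x) = χ (sliceRight ψ x) := by
  have h : ψ.comp (sliceLeft χ) = χ.comp (sliceRight ψ) := starAlgHom_ext fun a b => by
    simp only [StarAlgHom.comp_apply, sliceLeft_tmul, sliceRight_tmul, map_smul, smul_eq_mul,
      mul_comm]
  exact DFunLike.congr_fun h x

theorem map_scalarHom (χ : A →⋆ₐ[ℂ] ℂ) (g : B →⋆ₐ[ℂ] B') (x : SpatialTensor A B) :
    map (scalarHom χ A') g x = inr (g (sliceLeft χ x)) := by
  have h : map (scalarHom χ A') g = inr.comp (g.comp (sliceLeft χ)) := starAlgHom_ext fun a b => by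
    simp only [StarAlgHom.comp_apply, map_tmul, sliceLeft_tmul, scalarHom_apply, map_smul,
      inr_apply]
    rw [tmul, tmul, ← TensorProduct.smul_tmul', map_smul]
  exact DFunLike.congr_fun h x

end Slice

section MatrixCoeff

/-- The matrix coefficient `a ↦ ⟪ξ, ρ a η⟫` of a representation `ρ`. -/
noncomputable def matrixCoeff (ρ : Rep A) (ξ η : ρ.H) : A →L[ℂ] ℂ :=
  innerSL ℂ ξ ∘L ContinuousLinearMap.apply ℂ ρ.H η ∘L homCLM ρ.hom

theorem matrixCoeff_apply (ρ : Rep A) (ξ η : ρ.H) (a : A) :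
    matrixCoeff ρ ξ η a = ⟪ξ, ρ.hom a η⟫_ℂ := rfl

theorem matrixCoeff_comp (ρ : Rep A') (f : A →⋆ₐ[ℂ] A') (ξ η : ρ.H) (a : A) :
    matrixCoeff (ρ.comp f) ξ η a = matrixCoeff ρ ξ η (f a) := rfl

/-- The elementary tensor `ξ ⊗ η` of two vectors, in the space of the product representation. -/
noncomputable def vecTensor {ρ : Rep A} {σ : Rep B} (ξ : ρ.H) (η : σ.H) : (prodRep ρ σ).H :=
  (toHilbert (ξ ⊗ₜ[ℂ] η) : HilbertTensor ρ.H σ.H)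

variable {ρ : Rep A} {σ : Rep B}

theorem prodRep_tmul_vecTensor (a : A) (b : B) (ξ : ρ.H) (η : σ.H) :
    (prodRep ρ σ).hom (tmul a b) (vecTensor ξ η) = vecTensor (ρ.hom a ξ) (σ.hom b η) :=
  (DFunLike.congr_fun (prodRep_of ρ σ (a ⊗ₜ b)) (toHilbert (ξ ⊗ₜ η))).trans
    (opTensor_coe (ρ.hom a) (σ.hom b) (ξ ⊗ₜ η))

theorem inner_vecTensor (ξ ξ' : ρ.H) (η η' : σ.H) :
    ⟪(vecTensor ξ η : (prodRep ρ σ).H), vecTensor ξ' η'⟫_ℂ = ⟪ξ, ξ'⟫_ℂ * ⟪η, η'⟫_ℂ :=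
  ((toHilbert (H := ρ.H) (K := σ.H)).inner_map_map _ _).trans (TensorProduct.inner_tmul ℂ ξ ξ' η η')

theorem matrixCoeff_tmul (ξ ξ' : ρ.H) (η η' : σ.H) (a : A) (b : B) :
    matrixCoeff (prodRep ρ σ) (vecTensor ξ η) (vecTensor ξ' η') (tmul a b) =
      matrixCoeff ρ ξ ξ' a * matrixCoeff σ η η' b := by
  simp only [matrixCoeff_apply, prodRep_tmul_vecTensor, inner_vecTensor]

theorem matrixCoeff_map (f : A →⋆ₐ[ℂ] A') (g : B →⋆ₐ[ℂ] B') {ρ' : Rep A'} {σ' : Rep B'}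
    {ξ₁ ξ₂ : ρ.H} {ξ₁' ξ₂' : ρ'.H} {η₁ η₂ : σ.H} {η₁' η₂' : σ'.H}
    (hf : ∀ a, matrixCoeff ρ' ξ₁' ξ₂' (f a) = matrixCoeff ρ ξ₁ ξ₂ a)
    (hg : ∀ b, matrixCoeff σ' η₁' η₂' (g b) = matrixCoeff σ η₁ η₂ b) (x : SpatialTensor A B) :
    matrixCoeff (prodRep ρ' σ') (vecTensor ξ₁' η₁') (vecTensor ξ₂' η₂') (map f g x) =
      matrixCoeff (prodRep ρ σ) (vecTensor ξ₁ η₁) (vecTensor ξ₂ η₂) x := by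
  have h : matrixCoeff (prodRep ρ' σ') (vecTensor ξ₁' η₁') (vecTensor ξ₂' η₂') ∘L
        homCLM (map f g) =
      matrixCoeff (prodRep ρ σ) (vecTensor ξ₁ η₁) (vecTensor ξ₂ η₂) :=
    continuousLinearMap_ext fun a b => by
      rw [ContinuousLinearMap.comp_apply, homCLM_apply, map_tmul, matrixCoeff_tmul,
        matrixCoeff_tmul, hf, hg]
  exact DFunLike.congr_fun h x

theorem norm_le_of_forall_prodRep {x : SpatialTensor A B} {M : ℝ}
    (h : ∀ (ρ : Rep A) (σ : Rep B), ‖(prodRep ρ σ).hom x‖ ≤ M) : ‖x‖ ≤ M := by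
  refine le_of_forall_pos_le_add fun ε hε => ?_
  obtain ⟨t, ht⟩ := Metric.denseRange_iff.mp denseRange_coe x (ε / 2) (half_pos hε)
  rw [dist_eq_norm] at ht
  have hcoe : ‖coe t‖ ≤ M + ε / 2 := by
    rw [norm_coe]
    refine spatialNorm_le t fun ρ σ => ?_
    calc ‖algProdRep ρ.hom σ.hom t‖ = ‖(prodRep ρ σ).hom x - (prodRep ρ σ).hom (x - coe t)‖ := by
          rw [← map_sub, sub_sub_cancel]
          exact congrArg norm (prodRep_of ρ σ t).symm
      _ ≤ M + ε / 2 :=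
          norm_sub_le_of_le (h ρ σ) ((NonUnitalStarAlgHom.norm_apply_le _ _).trans ht.le)
  calc ‖x‖ = ‖coe t + (x - coe t)‖ := by rw [add_sub_cancel]
    _ ≤ (M + ε / 2) + ε / 2 := norm_add_le_of_le hcoe ht.le
    _ = M + ε := by ring

theorem eq_of_prodRep_eq {x y : SpatialTensor A B}
    (h : ∀ (ρ : Rep A) (σ : Rep B), (prodRep ρ σ).hom x = (prodRep ρ σ).hom y) : x = y := by
  refine sub_eq_zero.mp (norm_le_zero_iff.mp (norm_le_of_forall_prodRep fun ρ σ => ?_))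
  rw [map_sub, h, sub_self, norm_zero]

theorem operator_ext_of_inner_tmul {H K : Type u} [NormedAddCommGroup H] [InnerProductSpace ℂ H]
    [NormedAddCommGroup K] [InnerProductSpace ℂ K]
    {S T : HilbertTensor H K →L[ℂ] HilbertTensor H K}
    (h : ∀ (ξ ξ' : H) (η η' : K),
      ⟪toHilbert (ξ ⊗ₜ[ℂ] η), S (toHilbert (ξ' ⊗ₜ[ℂ] η'))⟫_ℂ =
        ⟪toHilbert (ξ ⊗ₜ[ℂ] η), T (toHilbert (ξ' ⊗ₜ[ℂ] η'))⟫_ℂ) : S = T := by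
  refine hilbertTensor_ext fun x => ?_
  induction x using TensorProduct.induction_on with
  | zero => simp only [map_zero]
  | add x y hx hy => simp only [map_add, hx, hy]
  | tmul ξ' η' =>
    refine ext_inner_left ℂ fun v => ?_
    induction v using HilbertTensor.induction with
    | hp => apply isClosed_eq <;> fun_prop
    | ih v =>
      induction v using TensorProduct.induction_on with
      | zero => simp only [map_zero, inner_zero_left]
      | add x y hx hy => simp only [map_add, inner_add_left, hx, hy]
      | tmul ξ η => exact h ξ ξ' η η'

theorem eq_of_matrixCoeff_eq {x y : SpatialTensor A B}
    (h : ∀ (ρ : Rep A) (σ : Rep B) (ξ ξ' : ρ.H) (η η' : σ.H),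
      matrixCoeff (prodRep ρ σ) (vecTensor ξ η) (vecTensor ξ' η') x =
        matrixCoeff (prodRep ρ σ) (vecTensor ξ η) (vecTensor ξ' η') y) : x = y :=
  eq_of_prodRep_eq fun ρ σ => operator_ext_of_inner_tmul (h ρ σ)

end MatrixCoeff

section CharRep

/-- The one-dimensional representation given by a character. -/
noncomputable def charRep (χ : A →⋆ₐ[ℂ] ℂ) : Rep A :=
  ⟨EuclideanSpace ℂ PUnit.{u + 1}, scalarHom χ _⟩

/-- The unit vector of the one-dimensional representation given by a character. -/
noncomputable def charVec (χ : A →⋆ₐ[ℂ] ℂ) : (charRep χ).H :=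
  (EuclideanSpace.single PUnit.unit (1 : ℂ) : EuclideanSpace ℂ PUnit.{u + 1})

theorem matrixCoeff_charRep (χ : A →⋆ₐ[ℂ] ℂ) (a : A) :
    matrixCoeff (charRep χ) (charVec χ) (charVec χ) a = χ a := by
  have haction : (charRep χ).hom a (charVec χ) = χ a • charVec χ :=
    DFunLike.congr_fun (scalarHom_apply χ ((charRep χ).H →L[ℂ] (charRep χ).H) a) (charVec χ)
  have hunit : ⟪charVec χ, charVec χ⟫_ℂ = 1 := by
    change ⟪EuclideanSpace.single PUnit.unit (1 : ℂ), EuclideanSpace.single PUnit.unit 1⟫_ℂ = 1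
    rw [EuclideanSpace.inner_single_left, PiLp.single_apply, if_pos rfl, map_one, mul_one]
  rw [matrixCoeff_apply, haction, inner_smul_right, hunit, mul_one]

theorem matrixCoeff_sliceLeft (χ : A →⋆ₐ[ℂ] ℂ) {σ : Rep B} (η η' : σ.H) (x : SpatialTensor A B) :
    matrixCoeff σ η η' (sliceLeft χ x) =
      matrixCoeff (prodRep (charRep χ) σ) (vecTensor (charVec χ) η) (vecTensor (charVec χ) η')
        x := by
  have h : matrixCoeff σ η η' ∘L homCLM (sliceLeft χ) =
      matrixCoeff (prodRep (charRep χ) σ) (vecTensor (charVec χ) η) (vecTensor (charVec χ) η') :=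
    continuousLinearMap_ext fun a b => by
      rw [ContinuousLinearMap.comp_apply, homCLM_apply, matrixCoeff_tmul, matrixCoeff_charRep,
        sliceLeft_tmul, map_smul, smul_eq_mul]
  exact DFunLike.congr_fun h x

theorem matrixCoeff_sliceRight (χ : B →⋆ₐ[ℂ] ℂ) {ρ : Rep A} (ξ ξ' : ρ.H) (x : SpatialTensor A B) :
    matrixCoeff ρ ξ ξ' (sliceRight χ x) =
      matrixCoeff (prodRep ρ (charRep χ)) (vecTensor ξ (charVec χ)) (vecTensor ξ' (charVec χ))
        x := by
  have h : matrixCoeff ρ ξ ξ' ∘L homCLM (sliceRight χ) =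
      matrixCoeff (prodRep ρ (charRep χ)) (vecTensor ξ (charVec χ)) (vecTensor ξ' (charVec χ)) :=
    continuousLinearMap_ext fun a b => by
      rw [ContinuousLinearMap.comp_apply, homCLM_apply, matrixCoeff_tmul, matrixCoeff_charRep,
        sliceRight_tmul, map_smul, smul_eq_mul, mul_comm]
  exact DFunLike.congr_fun h x

end CharRep

section Assoc

variable {C C' : Type u} [CStarAlgebra C] [CStarAlgebra C']
  {x : SpatialTensor (SpatialTensor A B) C} {y : SpatialTensor A (SpatialTensor B C)}

theorem AssocEq.matrixCoeff_eq (hxy : AssocEq x y) {ρ : Rep A} {σ : Rep B} {τ : Rep C}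
    (ξ ξ' : ρ.H) (η η' : σ.H) (ζ ζ' : τ.H) :
    matrixCoeff (prodRep (prodRep ρ σ) τ) (vecTensor (vecTensor ξ η) ζ)
        (vecTensor (vecTensor ξ' η') ζ') x =
      matrixCoeff (prodRep ρ (prodRep σ τ)) (vecTensor ξ (vecTensor η ζ))
        (vecTensor ξ' (vecTensor η' ζ')) y :=
  hxy ρ σ τ ξ ξ' η η' ζ ζ'

theorem AssocEq.map (hxy : AssocEq x y) (f : A →⋆ₐ[ℂ] A') (g : B →⋆ₐ[ℂ] B') (q : C →⋆ₐ[ℂ] C') :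
    AssocEq (SpatialTensor.map (SpatialTensor.map f g) q x)
      (SpatialTensor.map f (SpatialTensor.map g q) y) := by
  intro ρ σ τ ξ ξ' η η' ζ ζ'
  have hf a := (matrixCoeff_comp ρ f ξ ξ' a).symm
  have hg b := (matrixCoeff_comp σ g η η' b).symm
  have hq c := (matrixCoeff_comp τ q ζ ζ' c).symm
  exact (matrixCoeff_map _ q (matrixCoeff_map f g hf hg) hq x).trans
    ((hxy.matrixCoeff_eq _ _ _ _ _ _).trans
      (matrixCoeff_map f _ hf (matrixCoeff_map g q hg hq) y).symm)

theorem AssocEq.sliceLeft_eq (hxy : AssocEq x y) (χ : A →⋆ₐ[ℂ] ℂ) :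
    SpatialTensor.map (sliceLeft χ) (StarAlgHom.id ℂ C) x = sliceLeft χ y := by
  refine eq_of_matrixCoeff_eq fun σ τ η η' ζ ζ' => ?_
  rw [matrixCoeff_sliceLeft, ← hxy.matrixCoeff_eq]
  exact matrixCoeff_map _ _ (matrixCoeff_sliceLeft χ η η') (fun _ => rfl) x

theorem AssocEq.sliceRight_eq (hxy : AssocEq x y) (χ : C →⋆ₐ[ℂ] ℂ) :
    sliceRight χ x = SpatialTensor.map (StarAlgHom.id ℂ A) (sliceRight χ) y := by
  refine eq_of_matrixCoeff_eq fun ρ σ ξ ξ' η η' => ?_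
  rw [matrixCoeff_sliceRight, hxy.matrixCoeff_eq]
  exact (matrixCoeff_map _ _ (fun _ => rfl) (matrixCoeff_sliceRight χ η η') y).symm

end Assoc

end SpatialTensor

open SpatialTensor

section QuantumSubgroup

theorem dense_span_of_mapsTo {𝕜 E F : Type*} [Semiring 𝕜] [AddCommMonoid E] [Module 𝕜 E]
    [TopologicalSpace E] [AddCommMonoid F] [Module 𝕜 F] [TopologicalSpace F] {f : E →L[𝕜] F}
    (hf : DenseRange f) {s : Set E} {t : Set F} (hs : Dense (Submodule.span 𝕜 s : Set E))
    (hst : Set.MapsTo f s t) : Dense (Submodule.span 𝕜 t : Set F) := by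
  have hle : (Submodule.span 𝕜 s).map f.toLinearMap ≤ Submodule.span 𝕜 t := by
    rw [Submodule.map_span]
    exact Submodule.span_mono hst.image_subset
  exact (hf.dense_image f.continuous hs).mono hle

variable {A A' : Type u} [CStarAlgebra A] [CStarAlgebra A'] {Δ : A →⋆ₐ[ℂ] SpatialTensor A A}

theorem IsQuantumSubgroup.isCompactQuantumGroup {Δ' : A' →⋆ₐ[ℂ] SpatialTensor A' A'}
    {π : A →⋆ₐ[ℂ] A'} (h : IsQuantumSubgroup Δ Δ' π) (hΔ : IsCompactQuantumGroup Δ) :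
    IsCompactQuantumGroup Δ' where
  coassoc := h.surjective.forall.mpr fun a => by
    have hcomul : (map π π).comp Δ = Δ'.comp π := StarAlgHom.ext h.map_comul
    have hmap := (hΔ.coassoc a).map π π π
    rw [map_map, map_map, hcomul] at hmap
    rwa [← h.map_comul, map_map, map_map]
  dense_left := dense_span_of_mapsTo (f := homCLM (map π π))
    (denseRange_map h.surjective h.surjective) hΔ.dense_left (by
      rintro _ ⟨b, c, rfl⟩
      exact ⟨π b, π c, by rw [homCLM_apply, map_mul, map_tmul, map_one, h.map_comul]⟩)
  dense_right := dense_span_of_mapsTo (f := homCLM (map π π))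
    (denseRange_map h.surjective h.surjective) hΔ.dense_right (by
      rintro _ ⟨b, c, rfl⟩
      exact ⟨π b, π c, by rw [homCLM_apply, map_mul, map_tmul, map_one, h.map_comul]⟩)

variable {I : Ideal A} [I.IsTwoSided] [IsClosed (I : Set A)]

/-- The comultiplication induced by `Δ` on the quotient by a closed two-sided ideal `I`; the
hypothesis says that `Δ I` lies in the kernel of the quotient map of `A ⊗ A` onto
`(A ⧸ I) ⊗ (A ⧸ I)`. -/
noncomputable def quotientComul (Δ : A →⋆ₐ[ℂ] SpatialTensor A A)
    (hI : ∀ a ∈ I, map (quotientMk I) (quotientMk I) (Δ a) = 0) :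
    A ⧸ I →⋆ₐ[ℂ] SpatialTensor (A ⧸ I) (A ⧸ I) :=
  quotientLift ((map (quotientMk I) (quotientMk I)).comp Δ) hI

theorem isQuantumSubgroup_quotientComul
    (hI : ∀ a ∈ I, map (quotientMk I) (quotientMk I) (Δ a) = 0) :
    IsQuantumSubgroup Δ (quotientComul Δ hI) (quotientMk I) where
  surjective := quotientMk_surjective
  map_comul a :=
    (quotientLift_quotientMk ((map (quotientMk I) (quotientMk I)).comp Δ) hI a).symm

end QuantumSubgroup

section Stabilizer

variable {A C D E : Type u} [CStarAlgebra A] [CStarAlgebra C] [CStarAlgebra D] [CStarAlgebra E]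
  {Δ : A →⋆ₐ[ℂ] SpatialTensor A A} {δ : C →⋆ₐ[ℂ] SpatialTensor C A}
  {χ : WeakDual.characterSpace ℂ C}

theorem IsAction.comul_orbitMap (hδ : IsAction Δ δ) (χ : WeakDual.characterSpace ℂ C) (c : C) :
    Δ (orbitMap δ χ c) = map (orbitMap δ χ) (StarAlgHom.id ℂ A) (δ c) := by
  have h := (hδ c).sliceLeft_eq (charHom χ)
  rw [sliceLeft_map, map_map] at h
  exact h.symm

theorem IsAction.map_comul_orbitMap (hδ : IsAction Δ δ) {φ : A →⋆ₐ[ℂ] D}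
    (hφ : ∀ c, φ (orbitMap δ χ c) = χ c • (1 : D)) (g : A →⋆ₐ[ℂ] E) (c : C) :
    map φ g (Δ (orbitMap δ χ c)) = inr (g (orbitMap δ χ c)) := by
  have hcomp : φ.comp (orbitMap δ χ) = scalarHom (charHom χ) D :=
    StarAlgHom.ext fun c => (hφ c).trans (scalarHom_apply (charHom χ) D c).symm
  rw [hδ.comul_orbitMap, map_map, hcomp]
  exact map_scalarHom (charHom χ) g (δ c)

theorem IsAction.sliceRight_counit (hδ : IsAction Δ δ) (hinj : Function.Injective δ)
    {e : A →⋆ₐ[ℂ] ℂ} (he : IsCounit Δ e) (c : C) : sliceRight e (δ c) = c := by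
  have hcounit : (sliceRight e).comp Δ = StarAlgHom.id ℂ A := StarAlgHom.ext he
  have h := (hδ c).sliceRight_eq e
  rw [sliceRight_map, map_map, hcounit] at h
  exact hinj (h.trans (DFunLike.congr_fun map_id (δ c)))

theorem IsAction.counit_orbitMap (hδ : IsAction Δ δ) (hinj : Function.Injective δ)
    (χ : WeakDual.characterSpace ℂ C) {e : A →⋆ₐ[ℂ] ℂ} (he : IsCounit Δ e) (c : C) :
    e (orbitMap δ χ c) = χ c :=
  (apply_sliceLeft (charHom χ) e (δ c)).trans
    (congrArg χ (hδ.sliceRight_counit hinj he c))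

/-- The set `stabilizerIdeal δ χ`, as an ideal of `A`. -/
abbrev stabilizerClosedIdeal (δ : C →⋆ₐ[ℂ] SpatialTensor C A)
    (χ : WeakDual.characterSpace ℂ C) : Ideal A :=
  closedIdealSpan (Set.range fun c => orbitMap δ χ c - χ c • (1 : A))

theorem coe_stabilizerClosedIdeal :
    (stabilizerClosedIdeal δ χ : Set A) = stabilizerIdeal δ χ := rfl

theorem forall_mem_stabilizerClosedIdeal_apply_eq_zero_iff {φ : A →⋆ₐ[ℂ] D} :
    (∀ a ∈ stabilizerClosedIdeal δ χ, φ a = 0) ↔ ∀ c, φ (orbitMap δ χ c) = χ c • (1 : D) := by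
  simp only [forall_mem_closedIdealSpan_apply_eq_zero_iff, Set.forall_mem_range, map_sub, map_smul,
    map_one, sub_eq_zero]

theorem quotientMk_orbitMap (c : C) :
    quotientMk (stabilizerClosedIdeal δ χ) (orbitMap δ χ c) =
      χ c • (1 : A ⧸ stabilizerClosedIdeal δ χ) :=
  forall_mem_stabilizerClosedIdeal_apply_eq_zero_iff.mp
    (fun _ => quotientMk_eq_zero_iff.mpr) c

theorem IsAction.map_comul_eq_zero_of_mem_stabilizerClosedIdeal (hδ : IsAction Δ δ) {a : A}
    (ha : a ∈ stabilizerClosedIdeal δ χ) :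
    map (quotientMk (stabilizerClosedIdeal δ χ)) (quotientMk (stabilizerClosedIdeal δ χ)) (Δ a) =
      0 := by
  set q := quotientMk (stabilizerClosedIdeal δ χ)
  refine (forall_mem_stabilizerClosedIdeal_apply_eq_zero_iff (φ := (map q q).comp Δ)).mpr
    (fun c => ?_) a ha
  rw [StarAlgHom.comp_apply, hδ.map_comul_orbitMap quotientMk_orbitMap, quotientMk_orbitMap,
    map_smul, map_one]

/-- The orbit map `T_χ` with values in the right coset space of a quantum subgroup on which it is
the constant `χ`. -/
noncomputable def IsAction.orbitMapCoset (hδ : IsAction Δ δ) {π : A →⋆ₐ[ℂ] D}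
    (hπ : ∀ c, π (orbitMap δ χ c) = χ c • (1 : D)) : C →⋆ₐ[ℂ] rightCosetSpace Δ π :=
  (orbitMap δ χ).codRestrict (rightCosetSpace Δ π) (hδ.map_comul_orbitMap hπ (StarAlgHom.id ℂ A))

end Stabilizer

end CQG

/-- `(A, Δ)` is a compact quantum group, `δ` an action of it on `C`, `χ` a character of `C`, and
`CQG.orbitMap δ χ` is `T_χ = (χ ⊗ ι) ∘ δ`. The action of `(A, Δ)` on the right coset space is the
restriction of `Δ`, with values in the tensor product of the coset space with `A`, which sits in
`A ⊗ A` through the inclusion of the coset space in `A`. -/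
theorem mainTheorem2 {A C : Type u} [CStarAlgebra A] [CStarAlgebra C]
    (Δ : A →⋆ₐ[ℂ] CQG.SpatialTensor A A) (hΔ : CQG.IsCompactQuantumGroup Δ)
    (δ : C →⋆ₐ[ℂ] CQG.SpatialTensor C A) (hδ : CQG.IsAction Δ δ)
    (χ : WeakDual.characterSpace ℂ C) :
    (∃ (A' : Type u) (_ : CStarAlgebra A') (Δ' : A' →⋆ₐ[ℂ] CQG.SpatialTensor A' A')
      (π : A →⋆ₐ[ℂ] A'),
      CQG.IsCompactQuantumGroup Δ' ∧ CQG.IsQuantumSubgroup Δ Δ' π ∧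
      {a | π a = 0} = CQG.stabilizerIdeal δ χ ∧
      (∃ T : C →⋆ₐ[ℂ] CQG.rightCosetSpace Δ π,
        (∀ c, (T c : A) = CQG.orbitMap δ χ c) ∧
        ∀ c, CQG.SpatialTensor.map (CQG.rightCosetSpace Δ π).subtype (StarAlgHom.id ℂ A)
            (CQG.SpatialTensor.map T (StarAlgHom.id ℂ A) (δ c)) = Δ (T c)) ∧
      ∀ c, π (CQG.orbitMap δ χ c) = χ c • (1 : A')) ∧
    (Function.Injective δ → ∀ e : A →⋆ₐ[ℂ] ℂ, CQG.IsCounit Δ e →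
      ∀ c, e (CQG.orbitMap δ χ c) = χ c) := by
  refine ⟨?_, fun hinj e he c => hδ.counit_orbitMap hinj χ he c⟩
  have hcomul := fun a => hδ.map_comul_eq_zero_of_mem_stabilizerClosedIdeal (χ := χ) (a := a)
  have hsub := CQG.isQuantumSubgroup_quotientComul hcomul
  have hπ := CQG.quotientMk_orbitMap (δ := δ) (χ := χ)
  refine ⟨_, _, CQG.quotientComul Δ hcomul, CQG.quotientMk _, hsub.isCompactQuantumGroup hΔ, hsub,
    (Set.ext fun _ => CQG.quotientMk_eq_zero_iff).trans CQG.coe_stabilizerClosedIdeal,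
    ⟨hδ.orbitMapCoset hπ, fun _ => rfl, fun c => ?_⟩, hπ⟩
  rw [CQG.SpatialTensor.map_map]
  exact (hδ.comul_orbitMap χ c).symm
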